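/- Proposition 6.4. Let $F$ be an algebraically closed field of characteristic zero and let $V$ be a vector space over $F$ with basis $x_1,\dots,x_n$, regarded as a braided vector space of diagonal type with braiding $C(x_i\otimes x_j)=p_{ij}\,x_j\otimes x_i$, where $p_{ij}\in F^*$ for $1\le i,j\le n$. Let $\mathfrak B(V)=T(V)/\bigoplus_{m\ge 0}\ker\bigl(\sum_{\sigma\in\mathbb S_m}T_\sigma\bigr)$ be its Nichols algebra, where $T_\sigma:V^{\otimes m}\to V^{\otimes m}$ is the composition of the maps $\mathrm{id}\otimes C\otimes\mathrm{id}$ along a reduced expression of $\sigma$. Let $\mathfrak L^-(V)$ be the Lie subalgebra of $\mathfrak B(V)$ generated by $V$ under the bracket $[x,y]^-=yx-xy$. Let $\chi:\mathbb Z^n\times\mathbb Z^n\to F^*$ be the bicharacter with $\chi(e_i,e_j)=p_{ij}$, where $e_1,\dots,e_n$ is the standard basis of $\mathbb Z^n$, and put $p_{u,v}=\chi(\deg u,\deg v)$ for monomials $u,v$ in $x_1,\dots,x_n$, where $\deg x_i=e_i$. Order the generators by $x_1<x_2<\dots<x_n$. Then $\mathfrak B(V)=F\oplus\mathfrak L^-(V)$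 (internal direct sum of subspaces, $F=F\cdot 1$) if and only if the following three conditions hold: 1. $p_{ii}=-1$ for all $1\le i\le n$; 2. $p_{ij}p_{ji}=1$ for all $1\le i\ne j\le n$; 3. for every $m\ge1$ and all $h_1>h_2>\dots>h_m$ with $h_1,\dots,h_m\in\{x_1,\dots,x_n\}$ there exists $\tau\in\mathbb S_m$ such that $$\prod_{i=1}^{m-1}\bigl(p_{h_{\tau(i)},\,h_{\tau(i+1)}h_{\tau(i+2)}\cdots h_{\tau(m)}}-1\bigr)\neq0$$ (for $m=1$ the product is empty and equals $1$). -/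

import Mathlib

open scoped BigOperators

namespace NicholsDiag

noncomputable section

variable {F : Type*} [Field F] {n : ℕ}

/-! ### The braided vector space and its tensor algebra

`V` is the vector space with basis `x_1, …, x_n`, its tensor algebra `T(V)` is the free algebra on
`x_1, …, x_n`, and the braiding of `V` is `C (x_i ⊗ x_j) = q i j • x_j ⊗ x_i`. -/

/-- The monomial `x_{w 0} x_{w 1} ⋯ x_{w (m-1)}` of the tensor algebra. -/
def mono (F : Type*) [Field F] {m : ℕ} (w : Fin m → Fin n) : FreeAlgebra F (Fin n) :=
  (List.ofFn fun k => FreeAlgebra.ι F (w k)).prod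

/-- The monomials form a basis of the tensor algebra (see `wordBasis_apply`). -/
def wordBasis (F : Type*) [Field F] (n : ℕ) :
    Module.Basis (Σ m : ℕ, Fin m → Fin n) F (FreeAlgebra F (Fin n)) :=
  (FreeAlgebra.basisFreeMonoid F (Fin n)).reindex
    (FreeMonoid.toList.trans List.equivSigmaTuple)

/-- The scalar by which the braid lift `T_σ` of the permutation `σ` acts on the word `w`: one
factor `q a b` for each crossing of a letter `a` over a letter `b` standing to its right. -/
def crossing (q : Fin n → Fin n → Fˣ) {m : ℕ} (σ : Equiv.Perm (Fin m)) (w : Fin m → Fin n) : Fˣ :=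
  ∏ i, ∏ j, if i < j ∧ σ j < σ i then q (w i) (w j) else 1

/-- The quantum symmetrizer `∑_{σ ∈ S_m} T_σ` on a word of length `m`. Here `T_σ` is the
composition of the maps `id ⊗ C ⊗ id` along a reduced expression of `σ`, so `T_σ` moves the letter
at place `i` to place `σ i` and multiplies by `crossing q σ w`. -/
def symWord (q : Fin n → Fin n → Fˣ) {m : ℕ} (w : Fin m → Fin n) : FreeAlgebra F (Fin n) :=
  ∑ σ : Equiv.Perm (Fin m), ((crossing q σ w : Fˣ) : F) • mono F (w ∘ σ.symm)

/-- The direct sum of the quantum symmetrizers of all degrees, as a linear endomorphism of the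
tensor algebra. -/
def quantumSymmetrizer (q : Fin n → Fin n → Fˣ) :
    FreeAlgebra F (Fin n) →ₗ[F] FreeAlgebra F (Fin n) :=
  (wordBasis F n).constr F fun s => symWord q s.2

/-! ### The kernel of the quantum symmetrizer is a two-sided ideal -/

theorem mono_eq_lift {m : ℕ} (w : Fin m → Fin n) :
    mono F w = FreeAlgebra.basisFreeMonoid F (Fin n) (FreeMonoid.ofList (List.ofFn w)) := by
  have : FreeAlgebra.basisFreeMonoid F (Fin n) (FreeMonoid.ofList (List.ofFn w)) =
      FreeMonoid.lift (FreeAlgebra.ι F) (FreeMonoid.ofList (List.ofFn w)) := by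
    simp [FreeAlgebra.basisFreeMonoid, FreeAlgebra.equivMonoidAlgebraFreeMonoid]
  rw [this, FreeMonoid.lift_ofList, List.map_ofFn]
  rfl

theorem wordBasis_apply (m : ℕ) (w : Fin m → Fin n) : wordBasis F n ⟨m, w⟩ = mono F w := by
  rw [mono_eq_lift, wordBasis, Module.Basis.reindex_apply]
  rfl

theorem quantumSymmetrizer_mono (q : Fin n → Fin n → Fˣ) {m : ℕ} (w : Fin m → Fin n) :
    quantumSymmetrizer q (mono F w) = symWord q w := by
  rw [← wordBasis_apply, quantumSymmetrizer, Module.Basis.constr_basis]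

theorem mono_cons {m : ℕ} (x : Fin n) (w : Fin m → Fin n) :
    mono F ((0 : Fin (m + 1)).insertNth x w : Fin (m + 1) → Fin n) =
      FreeAlgebra.ι F x * mono F w := by
  simp [mono, List.ofFn_succ]

theorem mono_snoc {m : ℕ} (x : Fin n) (w : Fin m → Fin n) :
    mono F ((Fin.last m).insertNth x w : Fin (m + 1) → Fin n) =
      mono F w * FreeAlgebra.ι F x := by
  rw [mono, List.ofFn_succ']
  simp [mono, List.concat_eq_append, Fin.snoc_castSucc]

/-- The permutation with `a ↦ p` that acts on the other places as `ρ`, up to order-preserving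
relabelling. -/
def insertPerm {m : ℕ} (a : Fin (m + 1)) (s : Fin (m + 1) × Equiv.Perm (Fin m)) :
    Equiv.Perm (Fin (m + 1)) :=
  ((finSuccEquiv' a).trans (Equiv.optionCongr s.2)).trans (finSuccEquiv' s.1).symm

theorem insertPerm_self {m : ℕ} (a : Fin (m + 1)) (s : Fin (m + 1) × Equiv.Perm (Fin m)) :
    insertPerm a s a = s.1 := by
  simp [insertPerm]

theorem insertPerm_succAbove {m : ℕ} (a : Fin (m + 1)) (s : Fin (m + 1) × Equiv.Perm (Fin m))
    (i : Fin m) : insertPerm a s (a.succAbove i) = s.1.succAbove (s.2 i) := by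
  simp [insertPerm]

theorem insertPerm_bijective {m : ℕ} (a : Fin (m + 1)) :
    Function.Bijective (insertPerm a) := by
  rw [Fintype.bijective_iff_injective_and_card]
  constructor
  · rintro ⟨p, ρ⟩ ⟨p', ρ'⟩ h
    have h1 : p = p' := by
      have := congrArg (fun e => e a) h
      simpa [insertPerm_self] using this
    subst h1
    congr 1
    ext i
    have := congrArg (fun e => e (a.succAbove i)) h
    simp only [insertPerm_succAbove] at this
    rw [Fin.succAbove_right_injective this]
  · simp [Fintype.card_perm, Nat.factorial_succ]

theorem insertNth_comp_insertPerm_symm {m : ℕ} (a : Fin (m + 1))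
    (s : Fin (m + 1) × Equiv.Perm (Fin m)) (x : Fin n) (u : Fin m → Fin n) :
    (a.insertNth x u : Fin (m + 1) → Fin n) ∘ (insertPerm a s).symm =
      (s.1.insertNth x (u ∘ s.2.symm) : Fin (m + 1) → Fin n) := by
  rw [Equiv.comp_symm_eq]
  ext k
  refine Fin.succAboveCases a ?_ (fun i => ?_) k
  · simp [insertPerm_self]
  · simp [insertPerm_succAbove]

theorem crossing_insertPerm (q : Fin n → Fin n → Fˣ) {m : ℕ} (a : Fin (m + 1))
    (s : Fin (m + 1) × Equiv.Perm (Fin m)) (x : Fin n) (u : Fin m → Fin n) :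
    crossing q (insertPerm a s) (a.insertNth x u : Fin (m + 1) → Fin n) =
      (∏ k, (if a < a.succAbove k ∧ s.1.succAbove (s.2 k) < s.1 then q x (u k) else 1)) *
      (∏ k, (if a.succAbove k < a ∧ s.1 < s.1.succAbove (s.2 k) then q (u k) x else 1)) *
      crossing q s.2 u := by
  unfold crossing
  rw [Fin.prod_univ_succAbove _ a, Fin.prod_univ_succAbove _ a]
  simp only [Fin.prod_univ_succAbove _ a, Finset.prod_mul_distrib, insertPerm_self,
    insertPerm_succAbove, Fin.insertNth_apply_same, Fin.insertNth_apply_succAbove,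
    lt_self_iff_false, false_and, if_false, one_mul,
    (Fin.strictMono_succAbove _).lt_iff_lt, mul_assoc]

/-- Left quantum shuffle with a letter. -/
def shuffleLeft (q : Fin n → Fin n → Fˣ) (x : Fin n) :
    FreeAlgebra F (Fin n) →ₗ[F] FreeAlgebra F (Fin n) :=
  (wordBasis F n).constr F fun s => ∑ p : Fin (s.1 + 1),
    ((∏ k, (if p.succAbove k < p then q x (s.2 k) else 1) : Fˣ) : F) •
      mono F (p.insertNth x s.2 : Fin (s.1 + 1) → Fin n)

/-- Right quantum shuffle with a letter. -/
def shuffleRight (q : Fin n → Fin n → Fˣ) (x : Fin n) :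
    FreeAlgebra F (Fin n) →ₗ[F] FreeAlgebra F (Fin n) :=
  (wordBasis F n).constr F fun s => ∑ p : Fin (s.1 + 1),
    ((∏ k, (if p < p.succAbove k then q (s.2 k) x else 1) : Fˣ) : F) •
      mono F (p.insertNth x s.2 : Fin (s.1 + 1) → Fin n)

theorem symWord_insertNth (q : Fin n → Fin n → Fˣ) {m : ℕ} (a : Fin (m + 1)) (x : Fin n)
    (u : Fin m → Fin n) :
    symWord q (a.insertNth x u : Fin (m + 1) → Fin n) =
      ∑ ρ : Equiv.Perm (Fin m), ∑ p : Fin (m + 1),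
        ((crossing q (insertPerm a (p, ρ)) (a.insertNth x u : Fin (m + 1) → Fin n) : Fˣ) : F) •
          mono F (p.insertNth x (u ∘ ρ.symm) : Fin (m + 1) → Fin n) := by
  unfold symWord
  rw [← (insertPerm_bijective a).sum_comp, Fintype.sum_prod_type, Finset.sum_comm]
  simp only [insertNth_comp_insertPerm_symm]

theorem quantumSymmetrizer_ι_mul (q : Fin n → Fin n → Fˣ) (x : Fin n)
    (u : FreeAlgebra F (Fin n)) :
    quantumSymmetrizer q (FreeAlgebra.ι F x * u) = shuffleLeft q x (quantumSymmetrizer q u) := by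
  suffices h : (quantumSymmetrizer q).comp (LinearMap.mulLeft F (FreeAlgebra.ι F x)) =
      (shuffleLeft q x).comp (quantumSymmetrizer q) from LinearMap.congr_fun h u
  refine (wordBasis F n).ext ?_
  rintro ⟨m, w⟩
  rw [wordBasis_apply, LinearMap.comp_apply, LinearMap.comp_apply, LinearMap.mulLeft_apply,
    ← mono_cons, quantumSymmetrizer_mono, quantumSymmetrizer_mono, symWord_insertNth, symWord,
    map_sum]
  refine Finset.sum_congr rfl fun ρ _ => ?_
  rw [map_smul, ← wordBasis_apply m (w ∘ ρ.symm), shuffleLeft, Module.Basis.constr_basis,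
    Finset.smul_sum]
  refine Finset.sum_congr rfl fun p _ => ?_
  rw [smul_smul, crossing_insertPerm, ← Units.val_mul, mul_comm (crossing q ρ w)]
  congr 3
  simp only [Fin.succAbove_zero, Fin.succ_pos, true_and, Fin.not_lt_zero, false_and, if_false,
    Finset.prod_const_one, mul_one]
  refine Fintype.prod_equiv ρ _ _ fun k => ?_
  simp

theorem quantumSymmetrizer_mul_ι (q : Fin n → Fin n → Fˣ) (x : Fin n)
    (u : FreeAlgebra F (Fin n)) :
    quantumSymmetrizer q (u * FreeAlgebra.ι F x) = shuffleRight q x (quantumSymmetrizer q u) := by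
  suffices h : (quantumSymmetrizer q).comp (LinearMap.mulRight F (FreeAlgebra.ι F x)) =
      (shuffleRight q x).comp (quantumSymmetrizer q) from LinearMap.congr_fun h u
  refine (wordBasis F n).ext ?_
  rintro ⟨m, w⟩
  rw [wordBasis_apply, LinearMap.comp_apply, LinearMap.comp_apply, LinearMap.mulRight_apply,
    ← mono_snoc, quantumSymmetrizer_mono, quantumSymmetrizer_mono, symWord_insertNth, symWord,
    map_sum]
  refine Finset.sum_congr rfl fun ρ _ => ?_
  rw [map_smul, ← wordBasis_apply m (w ∘ ρ.symm), shuffleRight, Module.Basis.constr_basis,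
    Finset.smul_sum]
  refine Finset.sum_congr rfl fun p _ => ?_
  rw [smul_smul, crossing_insertPerm, ← Units.val_mul, mul_comm (crossing q ρ w)]
  congr 3
  simp only [Fin.succAbove_last, Fin.castSucc_lt_last, true_and, not_lt_of_ge (Fin.le_last _),
    false_and, if_false, Finset.prod_const_one, one_mul]
  refine Fintype.prod_equiv ρ _ _ fun k => ?_
  simp

theorem quantumSymmetrizer_mul_eq_zero (q : Fin n → Fin n → Fˣ) (a : FreeAlgebra F (Fin n)) :
    ∀ u, quantumSymmetrizer q u = 0 →
      quantumSymmetrizer q (a * u) = 0 ∧ quantumSymmetrizer q (u * a) = 0 := by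
  induction a using FreeAlgebra.induction with
  | grade0 r =>
    intro u hu
    rw [← Algebra.commutes r u, ← Algebra.smul_def, map_smul, hu, smul_zero]
    exact ⟨rfl, rfl⟩
  | grade1 x =>
    intro u hu
    rw [quantumSymmetrizer_ι_mul, quantumSymmetrizer_mul_ι, hu, map_zero, map_zero]
    exact ⟨rfl, rfl⟩
  | mul a b ha hb =>
    intro u hu
    rw [mul_assoc, ← mul_assoc u]
    exact ⟨(ha _ (hb u hu).1).1, (hb _ (ha u hu).2).2⟩
  | add a b ha hb =>
    intro u hu
    rw [add_mul, mul_add, map_add, map_add, (ha u hu).1, (ha u hu).2, (hb u hu).1, (hb u hu).2,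
      add_zero]
    exact ⟨rfl, rfl⟩

/-! ### The Nichols algebra and the Nichols Lie algebra -/

/-- The defining ideal of the Nichols algebra: the direct sum of the kernels of the quantum
symmetrizers. -/
def nicholsIdeal (q : Fin n → Fin n → Fˣ) : Ideal (FreeAlgebra F (Fin n)) where
  carrier := {u | quantumSymmetrizer q u = 0}
  add_mem' {a b} ha hb := by
    change quantumSymmetrizer q (a + b) = 0
    change quantumSymmetrizer q a = 0 at ha
    change quantumSymmetrizer q b = 0 at hb
    rw [map_add, ha, hb, add_zero]
  zero_mem' := map_zero _
  smul_mem' a u hu := (quantumSymmetrizer_mul_eq_zero q a u hu).1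

instance (q : Fin n → Fin n → Fˣ) : (nicholsIdeal q).IsTwoSided :=
  ⟨fun {u} a hu => (quantumSymmetrizer_mul_eq_zero q a u hu).2⟩

/-- The Nichols algebra of the braided vector space of diagonal type with braiding matrix `q`. -/
abbrev NicholsAlgebra (q : Fin n → Fin n → Fˣ) : Type _ :=
  FreeAlgebra F (Fin n) ⧸ nicholsIdeal q

/-- The basis element `x_i` of `V`, in the Nichols algebra. -/
def gen (q : Fin n → Fin n → Fˣ) (i : Fin n) : NicholsAlgebra q :=
  Ideal.Quotient.mk (nicholsIdeal q) (FreeAlgebra.ι F i)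

/-- The subspace `V` of the Nichols algebra. -/
def genSpace (q : Fin n → Fin n → Fˣ) : Submodule F (NicholsAlgebra q) :=
  Submodule.span F (Set.range (gen q))

section

attribute [local instance] LieRing.ofAssociativeRing

/-- The Nichols Lie algebra: the Lie subalgebra generated by `V` in the Nichols algebra, under the
commutator. (The commutators `y * x - x * y` and `x * y - y * x` have the same Lie subalgebras.) -/
def nicholsLieAlgebra (q : Fin n → Fin n → Fˣ) : Submodule F (NicholsAlgebra q) :=
  (LieSubalgebra.lieSpan F (NicholsAlgebra q) (genSpace q : Set (NicholsAlgebra q))).toSubmodule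

end

/-! ### The bicharacter -/

/-- The bicharacter `χ` on `ℤⁿ` with `χ(e_i, e_j) = q i j`. -/
def bichar (q : Fin n → Fin n → Fˣ) (a b : Fin n → ℤ) : Fˣ :=
  ∏ i, ∏ j, q i j ^ (a i * b j)

/-- The degree in `ℤⁿ` of a monomial, given as the list of its letters; `x_i` has degree `e_i`. -/
def deg (w : List (Fin n)) : Fin n → ℤ :=
  (w.map fun i => Pi.single i (1 : ℤ)).sum

/-- `p_{u,v} = χ(deg u, deg v)` for monomials `u` and `v`. -/
def pairing (q : Fin n → Fin n → Fˣ) (u v : List (Fin n)) : Fˣ :=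
  bichar q (deg u) (deg v)

end

end NicholsDiag

namespace NicholsDiag

noncomputable section

variable {F : Type*} [Field F] {n : ℕ}

/-! ### Monomials and word coefficients in the Nichols algebra -/

/-! Coefficients of the quantum symmetrizer descend to functionals on `NicholsAlgebra q`. A
functional Φ with Φ(xy) = Φ(yx) that kills the generators kills the Nichols Lie algebra L
(`map_eq_zero_of_mem_nicholsLieAlgebra`). The coefficient of the empty word thus gives F ∩ L = 0 for
every `q`. If moreover F + L is everything, a trace that kills 1 and the generators is zero; testing
this in degree two forces conditions 1 and 2.

Under these conditions x_i² = 0 and x_i x_j = q_ij x_j x_i, so monomials with a repeated letter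
vanish and rearrangements are proportional. For a letter a outside the word u, the commutator of x_a
with x_u is (1 - p_{a,u}⁻¹) x_a x_u: it is either zero or a nonzero multiple of a monomial. Since L
is generated under iterated adjoint actions of generators, it is spanned by the monomials of bracket
words (`monomial_mem_of_bracketWord`, `nicholsLieAlgebra_le_span`). Hence L contains all monomials
of positive degree exactly when every nonempty set of letters can be ordered into a bracket word,
which is condition 3. -/

/-- The monomial of the Nichols algebra with the given list of letters. -/
def monomial (q : Fin n → Fin n → Fˣ) (l : List (Fin n)) : NicholsAlgebra q :=
  (l.map (gen q)).prod

theorem monomial_nil (q : Fin n → Fin n → Fˣ) : monomial q [] = 1 := rfl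

theorem monomial_cons (q : Fin n → Fin n → Fˣ) (a : Fin n) (l : List (Fin n)) :
    monomial q (a :: l) = gen q a * monomial q l := by
  simp [monomial]

theorem monomial_singleton (q : Fin n → Fin n → Fˣ) (a : Fin n) :
    monomial q [a] = gen q a := by
  simp [monomial]

theorem monomial_append (q : Fin n → Fin n → Fˣ) (l l' : List (Fin n)) :
    monomial q (l ++ l') = monomial q l * monomial q l' := by
  simp [monomial]

theorem mk_mono (q : Fin n → Fin n → Fˣ) {m : ℕ} (w : Fin m → Fin n) :
    Ideal.Quotient.mk (nicholsIdeal q) (mono F w) = monomial q (List.ofFn w) := by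
  rw [mono, map_list_prod, List.map_ofFn, monomial, List.map_ofFn]
  rfl

theorem span_range_monomial (q : Fin n → Fin n → Fˣ) :
    Submodule.span F (Set.range (monomial q)) = ⊤ := by
  rw [eq_top_iff]
  rintro x -
  obtain ⟨u, rfl⟩ := Ideal.Quotient.mk_surjective x
  have hu : u ∈ Submodule.span F (Set.range (wordBasis F n)) := by
    rw [Module.Basis.span_eq]; trivial
  have key : Submodule.span F (Set.range (wordBasis F n)) ≤
      (Submodule.span F (Set.range (monomial q))).comap
        (Ideal.Quotient.mkₐ F (nicholsIdeal q)).toLinearMap := by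
    rw [Submodule.span_le]
    rintro _ ⟨⟨m, w⟩, rfl⟩
    refine Submodule.subset_span ⟨List.ofFn w, ?_⟩
    rw [wordBasis_apply, ← mk_mono]
    rfl
  exact key hu

/-- The coefficient of a word in the quantum symmetrization, as a linear functional on the Nichols
algebra. -/
def wordCoeff (q : Fin n → Fin n → Fˣ) (s : List (Fin n)) : NicholsAlgebra q →ₗ[F] F :=
  ((nicholsIdeal q).restrictScalars F).liftQ
    ((wordBasis F n).coord (List.equivSigmaTuple s) ∘ₗ quantumSymmetrizer q) fun u hu => by
      have h : quantumSymmetrizer q u = 0 := hu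
      simp [h]

theorem coord_mono (s : List (Fin n)) {m : ℕ} (w : Fin m → Fin n) :
    (wordBasis F n).coord (List.equivSigmaTuple s) (mono F w) =
      if List.ofFn w = s then 1 else 0 := by
  classical
  have h : (⟨m, w⟩ : Σ m : ℕ, Fin m → Fin n) = List.equivSigmaTuple (List.ofFn w) :=
    (List.equivSigmaTuple.apply_symm_apply ⟨m, w⟩).symm
  rw [← wordBasis_apply, Module.Basis.coord_apply, Module.Basis.repr_self,
    Finsupp.single_apply, h]
  simp only [EmbeddingLike.apply_eq_iff_eq]

theorem wordCoeff_monomial_ofFn (q : Fin n → Fin n → Fˣ) (s : List (Fin n)) {m : ℕ}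
    (w : Fin m → Fin n) :
    wordCoeff q s (monomial q (List.ofFn w)) = ∑ σ : Equiv.Perm (Fin m),
      if List.ofFn (w ∘ σ.symm) = s then ((crossing q σ w : Fˣ) : F) else 0 := by
  have h : wordCoeff q s (monomial q (List.ofFn w)) =
      (wordBasis F n).coord (List.equivSigmaTuple s) (quantumSymmetrizer q (mono F w)) := by
    rw [← mk_mono]
    rfl
  rw [h, quantumSymmetrizer_mono, symWord, map_sum]
  refine Finset.sum_congr rfl fun σ _ => ?_
  rw [map_smul, coord_mono, smul_eq_mul, mul_ite, mul_one, mul_zero]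

/-- The symmetrizer only rearranges letters, so it preserves the multidegree. -/
theorem wordCoeff_monomial_of_not_perm (q : Fin n → Fin n → Fˣ) {s l : List (Fin n)}
    (h : ¬ l.Perm s) : wordCoeff q s (monomial q l) = 0 := by
  rw [← List.ofFn_get l, wordCoeff_monomial_ofFn]
  refine Finset.sum_eq_zero fun σ _ => if_neg fun hs => h ?_
  rw [← hs]
  have := Equiv.Perm.ofFn_comp_perm σ.symm l.get
  rw [List.ofFn_get] at this
  exact this.symm

theorem crossing_one (q : Fin n → Fin n → Fˣ) {m : ℕ} (w : Fin m → Fin n) :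
    crossing q 1 w = 1 := by
  refine Finset.prod_eq_one fun i _ => Finset.prod_eq_one fun j _ => if_neg ?_
  rintro ⟨h, h'⟩
  exact lt_asymm h h'

/-- When the letters are distinct, only the identity permutation returns the word, with scalar 1. In
particular such a monomial is nonzero. -/
theorem wordCoeff_monomial_self (q : Fin n → Fin n → Fˣ) {l : List (Fin n)} (h : l.Nodup) :
    wordCoeff q l (monomial q l) = 1 := by
  have hl := List.ofFn_get l
  conv_lhs => rw [← hl]
  rw [wordCoeff_monomial_ofFn, Finset.sum_eq_single 1]
  · rw [crossing_one, Equiv.Perm.one_def, Equiv.refl_symm, Equiv.coe_refl, Function.comp_id,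
      if_pos rfl, Units.val_one]
  · rintro σ - hσ
    refine if_neg fun hs => hσ ?_
    have h1 : l.get ∘ σ.symm = l.get := List.ofFn_injective hs
    have h2 : ∀ i, σ.symm i = i := fun i => List.nodup_iff_injective_get.1 h (congrFun h1 i)
    ext i
    rw [← h2 (σ i)]
    simp
  · simp

theorem wordCoeff_pair (q : Fin n → Fin n → Fˣ) (s : List (Fin n)) (i j : Fin n) :
    wordCoeff q s (monomial q [i, j]) =
      (if [i, j] = s then 1 else 0) + if [j, i] = s then (q i j : F) else 0 := by
  have h : [i, j] = List.ofFn ![i, j] := by simp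
  have hu : (Finset.univ : Finset (Equiv.Perm (Fin 2))) = {1, Equiv.swap 0 1} := by decide
  conv_lhs => rw [h]
  rw [wordCoeff_monomial_ofFn, hu, Finset.sum_pair (by decide), crossing_one]
  rw [Equiv.Perm.one_def, Equiv.refl_symm, Equiv.coe_refl]
  have hc : crossing q (Equiv.swap 0 1) ![i, j] = q i j := by
    simp [crossing, Fin.prod_univ_two]
  rw [hc]
  simp [List.ofFn_succ]

/-! ### Traces vanish on the Nichols Lie algebra -/

/-- A functional that is invariant under exchanging two monomial factors is a trace. -/
theorem map_mul_comm_of_monomial (q : Fin n → Fin n → Fˣ) {Φ : NicholsAlgebra q →ₗ[F] F}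
    (hΦ : ∀ a b, Φ (monomial q (a ++ b)) = Φ (monomial q (b ++ a))) (x y : NicholsAlgebra q) :
    Φ (x * y) = Φ (y * x) := by
  have h (x : NicholsAlgebra q) : x ∈ Submodule.span F (Set.range (monomial q)) := by
    rw [span_range_monomial]; trivial
  induction h x using Submodule.span_induction with
  | zero => simp
  | add a b _ _ ha hb => rw [add_mul, mul_add, map_add, map_add, ha, hb]
  | smul c a _ ha => rw [smul_mul_assoc, mul_smul_comm, map_smul, map_smul, ha]
  | mem _ hx =>
    obtain ⟨a, rfl⟩ := hx
    induction h y using Submodule.span_induction with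
    | zero => simp
    | add b c _ _ hb hc => rw [add_mul, mul_add, map_add, map_add, hb, hc]
    | smul c b _ hb => rw [smul_mul_assoc, mul_smul_comm, map_smul, map_smul, hb]
    | mem _ hy =>
      obtain ⟨b, rfl⟩ := hy
      rw [← monomial_append, ← monomial_append, hΦ]

section

attribute [local instance] LieRing.ofAssociativeRing

theorem gen_mem_nicholsLieAlgebra (q : Fin n → Fin n → Fˣ) (i : Fin n) :
    gen q i ∈ nicholsLieAlgebra q :=
  LieSubalgebra.subset_lieSpan (Submodule.subset_span ⟨i, rfl⟩)

theorem sub_mem_nicholsLieAlgebra (q : Fin n → Fin n → Fˣ) {x y : NicholsAlgebra q}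
    (hx : x ∈ nicholsLieAlgebra q) (hy : y ∈ nicholsLieAlgebra q) :
    x * y - y * x ∈ nicholsLieAlgebra q :=
  (LieSubalgebra.lieSpan F (NicholsAlgebra q) (genSpace q : Set (NicholsAlgebra q))).lie_mem hx hy

/-- A trace kills every commutator, so only its values on the generators matter. -/
theorem map_eq_zero_of_mem_nicholsLieAlgebra (q : Fin n → Fin n → Fˣ)
    {Φ : NicholsAlgebra q →ₗ[F] F} (hgen : ∀ i, Φ (gen q i) = 0)
    (hΦ : ∀ a b, Φ (monomial q (a ++ b)) = Φ (monomial q (b ++ a)))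
    {x : NicholsAlgebra q} (hx : x ∈ nicholsLieAlgebra q) : Φ x = 0 := by
  refine LieSubalgebra.lieSpan_induction F (p := fun x _ => Φ x = 0) (fun x hx => ?_)
    (map_zero _) (fun x y _ _ hx hy => by rw [map_add, hx, hy, add_zero])
    (fun c x _ hx => by rw [map_smul, hx, smul_zero])
    (fun x y _ _ _ _ => ?_) hx
  · have : genSpace q ≤ LinearMap.ker Φ := by
      rw [genSpace, Submodule.span_le]
      rintro _ ⟨i, rfl⟩
      exact hgen i
    exact this hx
  · rw [Ring.lie_def, map_sub, map_mul_comm_of_monomial q hΦ, sub_self]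

/-- The Nichols Lie algebra lies in every subspace that contains the generators and is stable
under their adjoint actions. -/
theorem nicholsLieAlgebra_le (q : Fin n → Fin n → Fˣ) {N : Submodule F (NicholsAlgebra q)}
    (hgen : ∀ i, gen q i ∈ N)
    (had : ∀ i, ∀ y ∈ N, gen q i * y - y * gen q i ∈ N) : nicholsLieAlgebra q ≤ N := by
  intro x hx
  -- The claim is strengthened to stability of `N` under ad x; this passes to brackets by the Jacobi
  -- identity.
  suffices h : x ∈ N ∧ ∀ y ∈ N, ⁅x, y⁆ ∈ N from h.1
  refine LieSubalgebra.lieSpan_induction F (p := fun x _ => x ∈ N ∧ ∀ y ∈ N, ⁅x, y⁆ ∈ N)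
    (fun x hx => ?_) ⟨N.zero_mem, fun y _ => by rw [zero_lie]; exact N.zero_mem⟩
    (fun x y _ _ hx hy => ⟨N.add_mem hx.1 hy.1, fun z hz => by
      rw [add_lie]; exact N.add_mem (hx.2 z hz) (hy.2 z hz)⟩)
    (fun c x _ hx => ⟨N.smul_mem c hx.1, fun z hz => by
      rw [smul_lie]; exact N.smul_mem c (hx.2 z hz)⟩)
    (fun x y _ _ hx hy => ⟨hx.2 y hy.1, fun z hz => by
      rw [lie_lie]; exact N.sub_mem (hx.2 _ (hy.2 z hz)) (hy.2 _ (hx.2 z hz))⟩) hx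
  induction hx using Submodule.span_induction with
  | mem _ h =>
    obtain ⟨i, rfl⟩ := h
    exact ⟨hgen i, had i⟩
  | zero => exact ⟨N.zero_mem, fun y _ => by rw [zero_lie]; exact N.zero_mem⟩
  | add x y _ _ hx hy =>
    exact ⟨N.add_mem hx.1 hy.1, fun z hz => by
      rw [add_lie]; exact N.add_mem (hx.2 z hz) (hy.2 z hz)⟩
  | smul c x _ hx =>
    exact ⟨N.smul_mem c hx.1, fun z hz => by
      rw [smul_lie]; exact N.smul_mem c (hx.2 z hz)⟩

end

/-! ### Consequences of the decomposition in degrees zero and two -/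

theorem wordCoeff_gen_eq_zero (q : Fin n → Fin n → Fˣ) {s : List (Fin n)} (hs : s.length ≠ 1)
    (i : Fin n) : wordCoeff q s (gen q i) = 0 := by
  rw [← monomial_singleton]
  exact wordCoeff_monomial_of_not_perm q fun h => hs (by simpa using h.length_eq.symm)

theorem wordCoeff_one_eq_zero (q : Fin n → Fin n → Fˣ) {s : List (Fin n)} (hs : s ≠ []) :
    wordCoeff q s 1 = 0 := by
  rw [← monomial_nil]
  exact wordCoeff_monomial_of_not_perm q fun h => hs (List.nil_perm.1 h)

/-- The coefficient of the empty word is a trace that kills the generators and takes the value 1 at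
1. -/
theorem disjoint_one_nicholsLieAlgebra (q : Fin n → Fin n → Fˣ) :
    Disjoint (Submodule.span F {(1 : NicholsAlgebra q)}) (nicholsLieAlgebra q) := by
  rw [Submodule.disjoint_def]
  intro x hx hx'
  obtain ⟨c, rfl⟩ := Submodule.mem_span_singleton.1 hx
  have h := map_eq_zero_of_mem_nicholsLieAlgebra q (Φ := wordCoeff q [])
    (wordCoeff_gen_eq_zero q (by simp)) (fun a b => ?_) hx'
  · rw [map_smul, ← monomial_nil, wordCoeff_monomial_self q List.nodup_nil, smul_eq_mul,
      mul_one] at h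
    rw [h, zero_smul]
  · by_cases ha : a = []
    · simp [ha]
    · rw [wordCoeff_monomial_of_not_perm, wordCoeff_monomial_of_not_perm] <;> simp [ha]

/-- If `B = F ⊕ L`, then a functional that vanishes on `F` and `L` is zero. -/
theorem map_eq_zero_of_codisjoint (q : Fin n → Fin n → Fˣ)
    (h : Codisjoint (Submodule.span F {(1 : NicholsAlgebra q)}) (nicholsLieAlgebra q))
    {Φ : NicholsAlgebra q →ₗ[F] F} (h1 : Φ 1 = 0) (hL : ∀ x ∈ nicholsLieAlgebra q, Φ x = 0)
    (x : NicholsAlgebra q) : Φ x = 0 := by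
  have hle : Submodule.span F {(1 : NicholsAlgebra q)} ⊔ nicholsLieAlgebra q ≤
      LinearMap.ker Φ :=
    sup_le ((Submodule.span_singleton_le_iff_mem _ _).2 h1) hL
  rw [codisjoint_iff.1 h] at hle
  exact hle Submodule.mem_top

/-- In degree two, a functional supported on rearrangements of `[i, j]` is a trace as soon as it
agrees on `x_i x_j` and `x_j x_i`. -/
theorem map_append_comm_of_pair (q : Fin n → Fin n → Fˣ) {Φ : NicholsAlgebra q →ₗ[F] F}
    {i j : Fin n} (hsupp : ∀ l, ¬ l.Perm [i, j] → Φ (monomial q l) = 0)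
    (hsymm : Φ (monomial q [i, j]) = Φ (monomial q [j, i])) (a b : List (Fin n)) :
    Φ (monomial q (a ++ b)) = Φ (monomial q (b ++ a)) := by
  by_cases h : (a ++ b).Perm [i, j]
  · have hlen := h.length_eq
    match a, b with
    | [], b => simp
    | a, [] => simp
    | [x], [y] =>
      change Φ (monomial q [x, y]) = Φ (monomial q [y, x])
      have hxy : [x, y].Perm [i, j] := h
      have hx : x = i ∨ x = j := by simpa using hxy.subset (List.mem_cons_self)
      rcases hx with rfl | rfl
      · have := (List.perm_cons _).1 hxy
        rw [List.singleton_perm_singleton] at this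
        rw [this, hsymm]
      · have := (List.perm_cons _).1 (hxy.trans (List.Perm.swap _ _ _))
        rw [List.singleton_perm_singleton] at this
        rw [this, hsymm]
    | _ :: _ :: _, _ :: _ => simp at hlen
    | _ :: _, _ :: _ :: _ => simp at hlen; omega
  · rw [hsupp _ h, hsupp _ fun h' => h (List.perm_append_comm.trans h')]

/-- The coefficient of x_i x_i is a trace, and its value at x_i² is 1 + q_ii. -/
theorem self_eq_neg_one_of_codisjoint (q : Fin n → Fin n → Fˣ)
    (h : Codisjoint (Submodule.span F {(1 : NicholsAlgebra q)}) (nicholsLieAlgebra q))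
    (i : Fin n) : q i i = -1 := by
  have h0 := map_eq_zero_of_codisjoint q h (Φ := wordCoeff q [i, i])
    (wordCoeff_one_eq_zero q (by simp)) (fun x hx =>
      map_eq_zero_of_mem_nicholsLieAlgebra q (wordCoeff_gen_eq_zero q (by simp))
        (map_append_comm_of_pair q (fun l hl => wordCoeff_monomial_of_not_perm q hl) rfl) hx)
    (monomial q [i, i])
  rw [wordCoeff_pair, if_pos rfl, if_pos rfl] at h0
  ext
  rw [Units.val_neg, Units.val_one]
  linear_combination h0

theorem mul_eq_one_of_codisjoint (q : Fin n → Fin n → Fˣ)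
    (h : Codisjoint (Submodule.span F {(1 : NicholsAlgebra q)}) (nicholsLieAlgebra q))
    {i j : Fin n} (hij : i ≠ j) : q i j * q j i = 1 := by
  have h0 := map_eq_zero_of_codisjoint q h
    -- The weights are chosen so that x_i x_j and x_j x_i both get the value 1 - q_ij q_ji: Φ is
    -- then a trace, and its vanishing is the claim.
    (Φ := (1 - (q i j : F)) • wordCoeff q [i, j] + (1 - (q j i : F)) • wordCoeff q [j, i])
    (by simp [wordCoeff_one_eq_zero]) (fun x hx =>
      map_eq_zero_of_mem_nicholsLieAlgebra q (by simp [wordCoeff_gen_eq_zero])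
        (map_append_comm_of_pair q (i := i) (j := j) (fun l hl => ?_) ?_) hx)
    (monomial q [i, j])
  · simp [wordCoeff_pair, hij, hij.symm] at h0
    ext
    rw [Units.val_mul, Units.val_one]
    linear_combination -h0
  · have hl' : ¬ l.Perm [j, i] := fun h => hl (h.trans (List.Perm.swap _ _ _))
    simp [wordCoeff_monomial_of_not_perm q hl, wordCoeff_monomial_of_not_perm q hl']
  · simp [wordCoeff_pair, hij, hij.symm]
    ring

/-! ### Quantum exterior algebras -/

theorem pairing_nil (q : Fin n → Fin n → Fˣ) (a : Fin n) : pairing q [a] [] = 1 := by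
  simp [pairing, bichar, deg]

theorem pairing_cons (q : Fin n → Fin n → Fˣ) (a b : Fin n) (l : List (Fin n)) :
    pairing q [a] (b :: l) = q a b * pairing q [a] l := by
  have h : ∀ c : Fin n → ℤ, bichar q (Pi.single a 1) c = ∏ j, q a j ^ c j := fun c => by
    rw [bichar, Finset.prod_eq_single a (fun i _ hi => by simp [Pi.single_eq_of_ne hi]) (by simp)]
    simp
  have h' : deg [a] = Pi.single a 1 := by simp [deg]
  have h2 : ∏ j, q a j ^ (Pi.single b 1 : Fin n → ℤ) j = q a b := by
    rw [Finset.prod_eq_single b (fun i _ hi => by simp [Pi.single_eq_of_ne hi]) (by simp)]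
    simp
  rw [pairing, pairing, h', h, h]
  simp only [deg, List.map_cons, List.sum_cons, Pi.add_apply, zpow_add, Finset.prod_mul_distrib,
    h2]

theorem mk_eq_zero_iff (q : Fin n → Fin n → Fˣ) (u : FreeAlgebra F (Fin n)) :
    Ideal.Quotient.mk (nicholsIdeal q) u = 0 ↔ quantumSymmetrizer q u = 0 :=
  Ideal.Quotient.eq_zero_iff_mem

/-- In degree two the symmetrizer is 1 + C; its kernel supplies the quadratic relations. -/
theorem quantumSymmetrizer_ι_mul_ι (q : Fin n → Fin n → Fˣ) (i j : Fin n) :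
    quantumSymmetrizer q (FreeAlgebra.ι F i * FreeAlgebra.ι F j) =
      FreeAlgebra.ι F i * FreeAlgebra.ι F j +
        (q i j : F) • (FreeAlgebra.ι F j * FreeAlgebra.ι F i) := by
  have h : FreeAlgebra.ι F i * FreeAlgebra.ι F j = mono F ![i, j] := by simp [mono]
  have hu : (Finset.univ : Finset (Equiv.Perm (Fin 2))) = {1, Equiv.swap 0 1} := by decide
  conv_lhs => rw [h]
  rw [quantumSymmetrizer_mono, symWord, hu, Finset.sum_pair (by decide), crossing_one]
  rw [Equiv.Perm.one_def, Equiv.refl_symm, Equiv.coe_refl]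
  have hc : crossing q (Equiv.swap 0 1) ![i, j] = q i j := by
    simp [crossing, Fin.prod_univ_two]
  rw [hc]
  simp [mono, List.ofFn_succ]

theorem gen_mul_self (q : Fin n → Fin n → Fˣ) {i : Fin n} (h : q i i = -1) :
    gen q i * gen q i = 0 := by
  rw [gen, ← map_mul, mk_eq_zero_iff, quantumSymmetrizer_ι_mul_ι, h]
  simp

theorem gen_mul_gen (q : Fin n → Fin n → Fˣ) {i j : Fin n} (h : q i j * q j i = 1) :
    gen q i * gen q j = (q i j : F) • (gen q j * gen q i) := by
  have h' : (q i j : F) * q j i = 1 := by rw [← Units.val_mul, h, Units.val_one]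
  have h0 : Ideal.Quotient.mk (nicholsIdeal q) (FreeAlgebra.ι F i * FreeAlgebra.ι F j -
      (q i j : F) • (FreeAlgebra.ι F j * FreeAlgebra.ι F i)) = 0 := by
    rw [mk_eq_zero_iff, map_sub, map_smul, quantumSymmetrizer_ι_mul_ι,
      quantumSymmetrizer_ι_mul_ι, smul_add, smul_smul, h', one_smul]
    abel
  rw [map_sub, sub_eq_zero] at h0
  exact h0

section Exterior

variable (q : Fin n → Fin n → Fˣ) (h1 : ∀ i, q i i = -1)
  (h2 : ∀ i j, i ≠ j → q i j * q j i = 1)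

include h2

theorem gen_mul_monomial {a : Fin n} {l : List (Fin n)} (ha : a ∉ l) :
    gen q a * monomial q l = (pairing q [a] l : F) • (monomial q l * gen q a) := by
  induction l with
  | nil => simp [monomial_nil, pairing_nil]
  | cons b l ih =>
    rw [List.mem_cons, not_or] at ha
    rw [monomial_cons, ← mul_assoc, gen_mul_gen q (h2 _ _ ha.1), smul_mul_assoc, mul_assoc,
      ih ha.2, mul_smul_comm, smul_smul, pairing_cons, Units.val_mul, mul_assoc]

theorem monomial_mul_gen {a : Fin n} {l : List (Fin n)} (ha : a ∉ l) :
    monomial q l * gen q a = ((pairing q [a] l)⁻¹ : F) • (gen q a * monomial q l) := by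
  rw [gen_mul_monomial q h2 ha, smul_smul, inv_mul_cancel₀ (Units.ne_zero _), one_smul]

theorem exists_monomial_eq_smul_of_perm {l l' : List (Fin n)} (h : l.Perm l') :
    ∃ c : F, monomial q l = c • monomial q l' := by
  induction h with
  | nil => exact ⟨1, (one_smul _ _).symm⟩
  | cons x _ ih =>
    obtain ⟨c, hc⟩ := ih
    exact ⟨c, by rw [monomial_cons, hc, monomial_cons, mul_smul_comm]⟩
  | swap x y l =>
    rcases eq_or_ne x y with rfl | hxy
    · exact ⟨1, (one_smul _ _).symm⟩
    · refine ⟨q y x, ?_⟩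
      simp only [monomial_cons]
      rw [← mul_assoc, gen_mul_gen q (h2 _ _ hxy.symm), smul_mul_assoc, mul_assoc]
  | trans _ _ ih ih' =>
    obtain ⟨c, hc⟩ := ih
    obtain ⟨d, hd⟩ := ih'
    exact ⟨c * d, by rw [hc, hd, smul_smul]⟩

include h1

theorem gen_mul_monomial_of_mem {a : Fin n} {l : List (Fin n)} (ha : a ∈ l) :
    gen q a * monomial q l = 0 := by
  induction l with
  | nil => simp at ha
  | cons b l ih =>
    rw [monomial_cons, ← mul_assoc]
    rcases eq_or_ne a b with rfl | hab
    · rw [gen_mul_self q (h1 _), zero_mul]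
    · rw [gen_mul_gen q (h2 _ _ hab), smul_mul_assoc, mul_assoc,
        ih ((List.mem_cons.1 ha).resolve_left hab), mul_zero, smul_zero]

theorem monomial_mul_gen_of_mem {a : Fin n} {l : List (Fin n)} (ha : a ∈ l) :
    monomial q l * gen q a = 0 := by
  induction l with
  | nil => simp at ha
  | cons b l ih =>
    rw [monomial_cons, mul_assoc]
    by_cases hal : a ∈ l
    · rw [ih hal, mul_zero]
    · obtain rfl : a = b := (List.mem_cons.1 ha).resolve_right hal
      rw [monomial_mul_gen q h2 hal, mul_smul_comm, ← mul_assoc, gen_mul_self q (h1 _), zero_mul,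
        smul_zero]

theorem monomial_eq_zero_of_not_nodup {l : List (Fin n)} (hl : ¬ l.Nodup) :
    monomial q l = 0 := by
  induction l with
  | nil => simp at hl
  | cons b l ih =>
    rw [monomial_cons]
    by_cases hb : b ∈ l
    · exact gen_mul_monomial_of_mem q h1 h2 hb
    · rw [ih fun h => hl (List.nodup_cons.2 ⟨hb, h⟩), mul_zero]

end Exterior

/-! ### Iterated brackets of generators -/

/-- The words `h_1 ⋯ h_m` for which the scalars `p_{h_i, h_{i+1} ⋯ h_m}`, `i < m`, all differ
from `1`. -/
inductive BracketWord (q : Fin n → Fin n → Fˣ) : List (Fin n) → Prop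
  | singleton (a : Fin n) : BracketWord q [a]
  | cons {a : Fin n} {l : List (Fin n)} (hl : BracketWord q l) (ha : pairing q [a] l ≠ 1) :
      BracketWord q (a :: l)

/-- The tail must be nonempty: one-letter words are bracket words although the pairing with the
empty word is 1. -/
theorem bracketWord_cons_iff {q : Fin n → Fin n → Fˣ} {a : Fin n} {l : List (Fin n)}
    (hl : l ≠ []) : BracketWord q (a :: l) ↔ pairing q [a] l ≠ 1 ∧ BracketWord q l := by
  constructor
  · rintro (_ | ⟨h, ha⟩)
    · exact absurd rfl hl
    · exact ⟨ha, h⟩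
  · rintro ⟨ha, h⟩
    exact h.cons ha

/-- Of the m + 1 letters the last carries no condition; dropping i + 1 letters leaves those strictly
after letter i. -/
theorem bracketWord_ofFn_iff (q : Fin n → Fin n → Fˣ) {m : ℕ} (f : Fin (m + 1) → Fin n) :
    BracketWord q (List.ofFn f) ↔
      ∏ i : Fin m, ((pairing q [f i.castSucc] ((List.ofFn f).drop (i + 1)) : F) - 1) ≠ 0 := by
  induction m with
  | zero => simpa using BracketWord.singleton (f 0)
  | succ m ih =>
    have h := ih fun i => f i.succ
    rw [List.ofFn_succ, bracketWord_cons_iff (by simp), Fin.prod_univ_succ, mul_ne_zero_iff, h]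
    refine and_congr ?_ ?_
    · simp [sub_eq_zero]
    · simp

theorem monomial_mem_of_bracketWord (q : Fin n → Fin n → Fˣ) (h1 : ∀ i, q i i = -1)
    (h2 : ∀ i j, i ≠ j → q i j * q j i = 1) {l : List (Fin n)} (hl : BracketWord q l) :
    monomial q l ∈ nicholsLieAlgebra q := by
  induction hl with
  | singleton a =>
    rw [monomial_singleton]
    exact gen_mem_nicholsLieAlgebra q a
  | @cons a l _ ha ih =>
    rw [monomial_cons]
    -- Bracket words may repeat letters; the monomial is then zero.
    by_cases hal : a ∈ l
    · rw [gen_mul_monomial_of_mem q h1 h2 hal]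
      exact Submodule.zero_mem _
    · have hb := sub_mem_nicholsLieAlgebra q (gen_mem_nicholsLieAlgebra q a) ih
      have hc : (1 : F) - (pairing q [a] l : F)⁻¹ ≠ 0 := by
        rw [sub_ne_zero, ne_comm, inv_ne_one]
        simpa using ha
      rw [monomial_mul_gen q h2 hal, ← one_smul F (gen q a * monomial q l), smul_smul, mul_one,
        ← sub_smul] at hb
      exact (Submodule.smul_mem_iff _ hc).1 hb

/-- The span is stable under ad x_a: if a occurs in l, both products vanish; if the pairing is 1,
they commute; otherwise `a :: l` is again a bracket word. -/
theorem nicholsLieAlgebra_le_span (q : Fin n → Fin n → Fˣ) (h1 : ∀ i, q i i = -1)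
    (h2 : ∀ i j, i ≠ j → q i j * q j i = 1) :
    nicholsLieAlgebra q ≤ Submodule.span F (monomial q '' {l | BracketWord q l}) := by
  refine nicholsLieAlgebra_le q
    (fun i => Submodule.subset_span ⟨[i], .singleton i, monomial_singleton q i⟩) fun a y hy => ?_
  induction hy using Submodule.span_induction with
  | zero => simp
  | add x y _ _ hx hy =>
    rw [mul_add, add_mul, add_sub_add_comm]
    exact Submodule.add_mem _ hx hy
  | smul c x _ hx =>
    rw [mul_smul_comm, smul_mul_assoc, ← smul_sub]
    exact Submodule.smul_mem _ c hx
  | mem _ hx =>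
    obtain ⟨l, hl, rfl⟩ := hx
    by_cases hal : a ∈ l
    · rw [gen_mul_monomial_of_mem q h1 h2 hal, monomial_mul_gen_of_mem q h1 h2 hal, sub_zero]
      exact Submodule.zero_mem _
    · by_cases ha : pairing q [a] l = 1
      · rw [gen_mul_monomial q h2 hal, ha, Units.val_one, one_smul, sub_self]
        exact Submodule.zero_mem _
      · rw [monomial_mul_gen q h2 hal, ← monomial_cons]
        have hm : monomial q (a :: l) ∈ Submodule.span F (monomial q '' {l | BracketWord q l}) :=
          Submodule.subset_span ⟨_, BracketWord.cons hl ha, rfl⟩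
        exact Submodule.sub_mem _ hm (Submodule.smul_mem _ _ hm)

/-! ### Bracket words and the third condition -/

/-- If no rearrangement of s were a bracket word, `wordCoeff q s` would kill 1 and L by multidegree,
yet it is 1 at the monomial of s. -/
theorem exists_bracketWord_perm_of_codisjoint (q : Fin n → Fin n → Fˣ) (h1 : ∀ i, q i i = -1)
    (h2 : ∀ i j, i ≠ j → q i j * q j i = 1)
    (h : Codisjoint (Submodule.span F {(1 : NicholsAlgebra q)}) (nicholsLieAlgebra q))
    {s : List (Fin n)} (hs : s.Nodup) (hs0 : s ≠ []) : ∃ l, BracketWord q l ∧ l.Perm s := by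
  by_contra! hcon
  have h0 := map_eq_zero_of_codisjoint q h (Φ := wordCoeff q s) (wordCoeff_one_eq_zero q hs0)
    (fun x hx => ?_) (monomial q s)
  · rw [wordCoeff_monomial_self q hs] at h0
    exact one_ne_zero h0
  · have hle : Submodule.span F (monomial q '' {l | BracketWord q l}) ≤
        LinearMap.ker (wordCoeff q s) := by
      rw [Submodule.span_le]
      rintro _ ⟨l, hl, rfl⟩
      exact wordCoeff_monomial_of_not_perm q (hcon l hl)
    exact hle (nicholsLieAlgebra_le_span q h1 h2 hx)

theorem exists_ofFn_comp_eq_of_perm {α : Type*} {m : ℕ} {h : Fin m → α}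
    (hinj : Function.Injective h) {l : List α} (hl : l.Perm (List.ofFn h)) :
    ∃ τ : Equiv.Perm (Fin m), List.ofFn (h ∘ τ) = l := by
  have hlen : l.length = m := by simpa using hl.length_eq
  subst hlen
  have hmem : ∀ i, ∃ j, h j = l.get i := fun i => by
    simpa [List.mem_ofFn] using hl.subset (List.get_mem l i)
  choose τ hτ using hmem
  have hnd : l.Nodup := hl.nodup_iff.2 (List.nodup_ofFn.2 hinj)
  have hτinj : Function.Injective τ := fun i j hij =>
    List.nodup_iff_injective_get.1 hnd (by rw [← hτ, ← hτ, hij])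
  refine ⟨Equiv.ofBijective τ (Finite.injective_iff_bijective.1 hτinj), ?_⟩
  conv_rhs => rw [← List.ofFn_get l]
  exact congrArg List.ofFn (funext hτ)

/-- Each nonempty monomial is zero or, up to a scalar, the monomial of a bracket word. -/
theorem codisjoint_of_forall_exists (q : Fin n → Fin n → Fˣ) (h1 : ∀ i, q i i = -1)
    (h2 : ∀ i j, i ≠ j → q i j * q j i = 1)
    (h3 : ∀ (m : ℕ) (h : Fin (m + 1) → Fin n), StrictAnti h →
      ∃ τ : Equiv.Perm (Fin (m + 1)), BracketWord q (List.ofFn (h ∘ τ))) :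
    Codisjoint (Submodule.span F {(1 : NicholsAlgebra q)}) (nicholsLieAlgebra q) := by
  rw [codisjoint_iff, eq_top_iff, ← span_range_monomial q, Submodule.span_le]
  rintro _ ⟨l, rfl⟩
  by_cases hl : l = []
  · subst hl
    exact Submodule.mem_sup_left (Submodule.mem_span_singleton_self _)
  refine Submodule.mem_sup_right ?_
  by_cases hnd : l.Nodup
  -- Sorting the letters in decreasing order puts them in the form to which `h3` applies.
  · obtain ⟨s, hs, hsl⟩ : ∃ s : List (Fin n), s.SortedGT ∧ l.Perm s := by
      have hp := List.perm_insertionSort (· ≥ ·) l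
      refine ⟨_, List.SortedGE.sortedGT_of_nodup ?_ (hp.nodup_iff.2 hnd), hp.symm⟩
      exact (List.pairwise_insertionSort (· ≥ ·) l).sortedGE
    obtain ⟨m, hm⟩ : ∃ m, s.length = m + 1 :=
      Nat.exists_eq_succ_of_ne_zero (by rw [← hsl.length_eq]; simpa using hl)
    obtain ⟨f, rfl⟩ : ∃ f : Fin (m + 1) → Fin n, s = List.ofFn f :=
      ⟨s.get ∘ Fin.cast hm.symm, List.ext_get (by simp [hm]) fun k _ _ => by
        rw [List.get_ofFn]; rfl⟩
    obtain ⟨τ, hτ⟩ := h3 m f (List.sortedGT_ofFn_iff.1 hs)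
    obtain ⟨c, hc⟩ := exists_monomial_eq_smul_of_perm q h2
      (hsl.trans (Equiv.Perm.ofFn_comp_perm τ f).symm)
    rw [hc]
    exact Submodule.smul_mem _ c (monomial_mem_of_bracketWord q h1 h2 hτ)
  · rw [monomial_eq_zero_of_not_nodup q h1 h2 hnd]
    exact Submodule.zero_mem _

end

end NicholsDiag

theorem proposition6p4 {F : Type*} [Field F] [IsAlgClosed F] [CharZero F] {n : ℕ}
    (q : Fin n → Fin n → Fˣ) :
    IsCompl (Submodule.span F {(1 : NicholsDiag.NicholsAlgebra q)})
        (NicholsDiag.nicholsLieAlgebra q) ↔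
      (∀ i, q i i = -1) ∧ (∀ i j, i ≠ j → q i j * q j i = 1) ∧
      ∀ (m : ℕ) (h : Fin (m + 1) → Fin n), StrictAnti h →
        ∃ τ : Equiv.Perm (Fin (m + 1)),
          ∏ i : Fin m,
            ((NicholsDiag.pairing q [h (τ i.castSucc)]
              ((List.ofFn fun j => h (τ j)).drop (i + 1)) : F) - 1) ≠ 0 := by
  open NicholsDiag in
  constructor
  · intro hc
    have h1 := self_eq_neg_one_of_codisjoint q hc.codisjoint
    have h2 : ∀ i j, i ≠ j → q i j * q j i = 1 :=
      fun i j hij => mul_eq_one_of_codisjoint q hc.codisjoint hij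
    refine ⟨h1, h2, fun m h hanti => ?_⟩
    obtain ⟨l, hl, hperm⟩ := exists_bracketWord_perm_of_codisjoint q h1 h2 hc.codisjoint
      (List.nodup_ofFn.2 hanti.injective) (by simp)
    obtain ⟨τ, rfl⟩ := exists_ofFn_comp_eq_of_perm hanti.injective hperm
    exact ⟨τ, (bracketWord_ofFn_iff q fun j => h (τ j)).1 hl⟩
  · rintro ⟨h1, h2, h3⟩
    refine ⟨disjoint_one_nicholsLieAlgebra q, codisjoint_of_forall_exists q h1 h2 ?_⟩
    intro m h hanti
    obtain ⟨τ, hτ⟩ := h3 m h hanti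
    exact ⟨τ, (bracketWord_ofFn_iff q fun j => h (τ j)).2 hτ⟩
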